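/- For a prime power $q$ and $n\ge 0$, let $G_q$ be the $q\times q$ Reed--Solomon kernel over $\mathbb F_q$: its columns are indexed by the elements $x\in\mathbb F_q$ and its row $i\in\{0,\dots,q-1\}$ is $(x^{q-1-i})_{x\in\mathbb F_q}$ (with $0^0=1$). The $q$-ary polar transform of length $N=q^n$ maps $u\in\mathbb F_q^N$ to $uG_q^{\otimes n}$. The codeword is sent over the $q$-ary erasure channel (QEC) with erasure probability $\epsilon$, which erases each code symbol independently with probability $\epsilon$. For $0\le i<N$ the $i$-th effective channel has input $u_i$ and output the received word together with $u_0,\dots,u_{i-1}$; its erasure rate is the probability, for uniformly distributed $u$, that this output does not determine $u_i$. **Corollary.** Let $\epsilon\in[0,1]$. For any $\gamma>0$ and $\delta>0$, there are $\beta\in(0,\frac12]$ and $q_0$ such that, for all prime powers $q\ge q_0$ and all $n\ge 0$, with $N=q^n$, the fraction of the $N$ effective channels whose erasure rate is at most $N^{-\gamma}$ is at least $$1-\epsilon-5N^{-\frac12+\delta}.$$ In particular this fraction is at least $1-\epsilon-O(N^{-1/2+\delta})$. (The number $\beta$ does not occur in the conclusion.) -/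

import Mathlib

noncomputable section

namespace RSPolar

variable (F : Type*) [Field F] [Fintype F]

/-- Positions of the input symbols of a length `q ^ n` polar code, `q = |F|`: the base-`q` digits
`(i₀, …, i_{n-1})` of a number in `{0, …, q ^ n - 1}`, most significant digit first.
The lexicographic order on them is the usual order of numbers. -/
abbrev Idx (n : ℕ) : Type := Fin n → Fin (Fintype.card F)

/-- Positions of the code symbols. The columns of the kernel are labelled by the `q` evaluation
points, so a code position is an `n`-tuple of field elements. -/
abbrev Pos (n : ℕ) : Type _ := Fin n → F

/-- The `q × q` Reed–Solomon kernel: row `i` (for `i = 0, …, q - 1`) is the evaluation of the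
monomial `x ^ (q - 1 - i)` at all the elements of `F`; the last row is the all-one vector. -/
def kernel : Matrix (Fin (Fintype.card F)) F F :=
  fun i x => x ^ (Fintype.card F - 1 - (i : ℕ))

/-- The polar transform, i.e. the `n`-fold Kronecker power of the kernel. -/
def transform (n : ℕ) : Matrix (Idx F n) (Pos F n) F :=
  fun i k => ∏ t, kernel F (i t) (k t)

variable {F}

/-- The codeword of the input vector `u`. -/
def encode {n : ℕ} (u : Idx F n → F) : Pos F n → F :=
  Matrix.vecMul u (transform F n)

open Classical in
/-- The word received when `x` is sent and exactly the positions in `E` are erased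
(`none` is the erasure symbol). -/
def receive {n : ℕ} (E : Finset (Pos F n)) (x : Pos F n → F) : Pos F n → Option F :=
  fun k => if k ∈ E then none else some (x k)

/-- The `i`-th effective channel has input `u i` and output the received word together with the
previous input symbols `u j`, `j < i` (the later input symbols being unknown). When `u` is sent
with erasure pattern `E`, its output is an erasure if it does not determine `u i`: some other
input vector gives the same output but has a different `i`-th symbol. -/
def IsErased {n : ℕ} (u : Idx F n → F) (E : Finset (Pos F n)) (i : Idx F n) : Prop :=
  ∃ v : Idx F n → F, (∀ j, toLex j < toLex i → v j = u j) ∧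
    receive E (encode v) = receive E (encode u) ∧ v i ≠ u i

variable (F)

/-- The probability that the memoryless `q`-ary erasure channel with erasure probability `ε`
erases exactly the positions in `E`. -/
def patternProb (ε : ℝ) {n : ℕ} (E : Finset (Pos F n)) : ℝ :=
  ε ^ E.card * (1 - ε) ^ (Fintype.card F ^ n - E.card)

open Classical in
/-- The erasure rate of the `i`-th effective channel after `n` polarization steps: the probability
of an erasure at its output, for a uniformly random input vector sent over the `q`-ary erasure
channel with erasure probability `ε`. -/
def erasureRate (ε : ℝ) (n : ℕ) (i : Idx F n) : ℝ :=
  (∑ u : Idx F n → F, ∑ E : Finset (Pos F n), if IsErased u E i then patternProb F ε E else 0) /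
    (Fintype.card (Idx F n → F) : ℝ)

open Classical in
/-- The fraction of the `q ^ n` effective channels whose erasure rate is at most `η`. -/
def fractionAtMost (ε : ℝ) (n : ℕ) (η : ℝ) : ℝ :=
  ((Finset.univ.filter fun i : Idx F n => erasureRate F ε n i ≤ η).card : ℝ) /
    (Fintype.card F : ℝ) ^ n

end RSPolar

end

/-!
By linearity, whether an erasure pattern makes an effective channel fail does not depend on the
input, so one may take the input to be zero.

Split the code positions into `q ^ (n - 1)` copies of the kernel. A combination of the kernel rows
from `m` on is a polynomial of degree at most `q - 1 - m`, so a copy with at most `m` erasures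
determines its `m`-th input. A first digit `m` therefore turns the channel with erasure probability
`x` into one with erasure probability at most the binomial tail `T m x = P (Bin (q, x) > m)`, and
iterating gives a process that dominates the erasure rates.

The tails `T m x`, for `m < q`, have sum `q x`, so the mean of the process over all positions is
constant. They differ substantially from `0` and `1` only for `m` in a window of width `√(q x)`
around `q x`, so the mean of the potential `(x (1 - x)) ^ β` decreases in each step by a factor of
order `q ^ (-1/2)`. After `n` steps it is at most `N ^ (-1/2 + s)`, for any `s > 0` once `q` is
large. A value `z > N ^ (-γ)` satisfies `1 ≤ z + N ^ (γ β) (z (1 - z)) ^ β`; averaging over all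
positions and choosing `β` with `γ β < δ` gives the bound.
-/

noncomputable section

namespace RSPolar

open MeasureTheory ProbabilityTheory Finset
open scoped unitInterval

theorem integral_binomial_symm (q : ℕ) (x : I) (f : ℕ → ℝ) :
    ∫ k, f (q - k) ∂Bin(q, σ x) = ∫ k, f k ∂Bin(q, x) := by
  simp only [integral_binomial, ← Nat.range_succ_eq_Iic]
  rw [← sum_range_reflect]
  refine sum_congr rfl fun k hk => ?_
  have hk : k ≤ q := Nat.lt_succ_iff.1 (mem_range.1 hk)
  rw [Nat.add_sub_cancel, Nat.choose_symm hk, Nat.sub_sub_self hk, unitInterval.coe_symm_eq,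
    sub_sub_cancel]
  simp only [smul_eq_mul]
  ring

theorem integral_pow_binomial (q : ℕ) (x : I) (g : ℝ) :
    ∫ k, g ^ k ∂Bin(q, x) = (1 + x * (g - 1)) ^ q := by
  have h : 1 + x * (g - 1) = x * g + (1 - x) := by ring
  rw [integral_binomial, ← Nat.range_succ_eq_Iic, h, add_pow]
  refine sum_congr rfl fun k _ => ?_
  rw [smul_eq_mul, mul_pow]
  ring

theorem mgf_binomial (q : ℕ) (x : I) (s : ℝ) :
    mgf (Nat.cast : ℕ → ℝ) Bin(q, x) s = (1 + x * (Real.exp s - 1)) ^ q := by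
  simp only [← integral_pow_binomial, mgf, ← Real.exp_nat_mul, mul_comm s]

theorem integral_natCast_binomial (q : ℕ) (x : I) : ∫ k, (k : ℝ) ∂Bin(q, x) = q * x := by
  have h := congrArg (Polynomial.eval (x : ℝ)) (bernsteinPolynomial.sum_smul ℝ q)
  simp only [Polynomial.eval_finsetSum, nsmul_eq_mul, Polynomial.eval_mul, Polynomial.eval_natCast,
    Polynomial.eval_X, bernsteinPolynomial, Polynomial.eval_pow, Polynomial.eval_sub,
    Polynomial.eval_one] at h
  rw [integral_binomial, ← Nat.range_succ_eq_Iic, ← h]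
  exact sum_congr rfl fun k _ => by rw [smul_eq_mul, mul_comm]

/-- The probability that a binomial variable with parameters `q` and `x` exceeds `m`. -/
def binomialTail (q m : ℕ) (x : I) : I :=
  ⟨Bin(q, x).real (Set.Ioi m), measureReal_nonneg, measureReal_le_one⟩

theorem coe_binomialTail (q m : ℕ) (x : I) :
    (binomialTail q m x : ℝ) = Bin(q, x).real (Set.Ioi m) := rfl

theorem coe_symm_binomialTail (q m : ℕ) (x : I) :
    (σ (binomialTail q m x) : ℝ) = Bin(q, x).real (Set.Iic m) := by
  rw [unitInterval.coe_symm_eq, coe_binomialTail, ← Set.compl_Ioi,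
    probReal_compl_eq_one_sub .of_discrete]

theorem binomialTail_symm {q m : ℕ} (hm : m < q) (x : I) :
    binomialTail q (q - 1 - m) (σ x) = σ (binomialTail q m x) := by
  ext
  rw [coe_symm_binomialTail, coe_binomialTail, ← integral_indicator_one .of_discrete,
    ← integral_indicator_one .of_discrete, ← integral_binomial_symm q x]
  congr 1
  funext k
  exact Set.indicator_eq_indicator (by simp only [Set.mem_Ioi, Set.mem_Iic]; omega) rfl

theorem sum_binomialTail (q : ℕ) (x : I) : ∑ m ∈ range q, (binomialTail q m x : ℝ) = q * x := by
  have htail (m : ℕ) :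
      (binomialTail q m x : ℝ) = ∫ k, (Set.Ioi m).indicator (1 : ℕ → ℝ) k ∂Bin(q, x) :=
    (integral_indicator_one .of_discrete).symm
  have hcount {k : ℕ} (hk : k ≤ q) : ∑ m ∈ range q, (Set.Ioi m).indicator (1 : ℕ → ℝ) k = k := by
    have hrange : {m ∈ range q | m < k} = range k := by
      ext m
      simp only [mem_filter, mem_range]
      omega
    simp only [Set.indicator_apply, Set.mem_Ioi, Pi.one_apply, sum_boole, hrange, card_range]
  simp only [htail]
  rw [← integral_finsetSum _ fun m _ => integrable_binomial _, ← integral_natCast_binomial]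
  refine integral_congr_ae ?_
  filter_upwards [ae_le_of_hasLaw_binomial HasLaw.id] with k hk using hcount hk

theorem mgf_binomial_le_exp (q : ℕ) (x : I) {s : ℝ} (hs : |s| ≤ 1) :
    mgf (Nat.cast : ℕ → ℝ) Bin(q, x) s ≤ Real.exp (q * x * (s + s ^ 2)) := by
  have hexp : Real.exp s - 1 ≤ s + s ^ 2 := by
    linarith [(abs_le.1 (Real.abs_exp_sub_one_sub_id_le hs)).2]
  have hbase : 0 ≤ 1 + x * (Real.exp s - 1) := by
    nlinarith [x.2.1, x.2.2, mul_nonneg x.2.1 (Real.exp_nonneg s)]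
  calc mgf (Nat.cast : ℕ → ℝ) Bin(q, x) s = (1 + x * (Real.exp s - 1)) ^ q := mgf_binomial q x s
    _ ≤ Real.exp ((x : ℝ) * (s + s ^ 2)) ^ q := by
        gcongr
        calc 1 + x * (Real.exp s - 1) ≤ x * (s + s ^ 2) + 1 := by
              linarith [mul_le_mul_of_nonneg_left hexp x.2.1]
          _ ≤ _ := Real.add_one_le_exp _
    _ = _ := by rw [← Real.exp_nat_mul, mul_assoc]

theorem mul_symm_binomialTail_le_exp (q m : ℕ) (x : I) {s : ℝ} (hs₀ : 0 ≤ s) (hs₁ : s ≤ 1) :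
    (binomialTail q m x * σ (binomialTail q m x) : ℝ) ≤
      Real.exp ((q : ℝ) * x * s ^ 2 - s * |m - (q : ℝ) * x|) := by
  have hintegrable (t : ℝ) : Integrable (fun k : ℕ => Real.exp (t * k)) Bin(q, x) :=
    integrable_binomial _
  rcases le_total (q * x : ℝ) m with h | h
  · calc (binomialTail q m x * σ (binomialTail q m x) : ℝ) ≤ binomialTail q m x :=
          mul_le_of_le_one_right (binomialTail q m x).2.1 (σ (binomialTail q m x)).2.2
      _ ≤ Bin(q, x).real {k : ℕ | (m : ℝ) ≤ k} :=
          measureReal_mono fun k hk => Set.mem_ofPred.2 (Nat.cast_le.2 (le_of_lt hk))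
      _ ≤ Real.exp (-s * m) * mgf (Nat.cast : ℕ → ℝ) Bin(q, x) s :=
          measure_ge_le_exp_mul_mgf _ hs₀ (hintegrable s)
      _ ≤ Real.exp (-s * m) * Real.exp (q * x * (s + s ^ 2)) := by
          gcongr
          exact mgf_binomial_le_exp q x (by rwa [abs_of_nonneg hs₀])
      _ = _ := by
          rw [← Real.exp_add, abs_of_nonneg (sub_nonneg.2 h)]
          ring_nf
  · calc (binomialTail q m x * σ (binomialTail q m x) : ℝ) ≤ σ (binomialTail q m x) :=
          mul_le_of_le_one_left (σ (binomialTail q m x)).2.1 (binomialTail q m x).2.2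
      _ = Bin(q, x).real {k : ℕ | (k : ℝ) ≤ m} := by
          simp only [coe_symm_binomialTail, Set.Iic, Nat.cast_le]
      _ ≤ Real.exp (-(-s) * m) * mgf (Nat.cast : ℕ → ℝ) Bin(q, x) (-s) :=
          measure_le_le_exp_mul_mgf _ (neg_nonpos.2 hs₀) (hintegrable (-s))
      _ ≤ Real.exp (-(-s) * m) * Real.exp (q * x * (-s + (-s) ^ 2)) := by
          gcongr
          exact mgf_binomial_le_exp q x (by rwa [abs_neg, abs_of_nonneg hs₀])
      _ = _ := by
          rw [← Real.exp_add, abs_of_nonpos (sub_nonpos.2 h)]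
          ring_nf

theorem binomialTail_le_of_mean_le_one (q m : ℕ) {x : I} (hqx : (q * x : ℝ) ≤ 1) :
    (binomialTail q m x : ℝ) ≤ 2 * (q * x) * (1 / 2) ^ m := by
  have hy : (0 : ℝ) ≤ q * x := mul_nonneg q.cast_nonneg x.2.1
  -- Markov's inequality for `2 ^ k - 1`: subtracting `1` makes the mean vanish with `q * x`.
  have hmarkov : 2 ^ m * (binomialTail q m x : ℝ) ≤ 2 * (q * x) := by
    calc 2 ^ m * (binomialTail q m x : ℝ)
        ≤ 2 ^ m * Bin(q, x).real {k : ℕ | (2 : ℝ) ^ m ≤ 2 ^ k - 1} := by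
          gcongr
          refine measureReal_mono fun k hk => Set.mem_ofPred.2 ?_
          have hpow : (2 : ℝ) ^ (m + 1) ≤ 2 ^ k := pow_le_pow_right₀ one_le_two hk
          have hone : (1 : ℝ) ≤ 2 ^ m := one_le_pow₀ one_le_two
          rw [pow_succ] at hpow
          linarith
      _ ≤ ∫ k, ((2 : ℝ) ^ k - 1) ∂Bin(q, x) :=
          mul_meas_ge_le_integral_of_nonneg
            (.of_forall fun k => sub_nonneg.2 (one_le_pow₀ one_le_two)) (integrable_binomial _) _
      _ = (1 + x) ^ q - 1 := by
          rw [integral_sub (integrable_binomial _) (integrable_binomial _), integral_pow_binomial]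
          norm_num
      _ ≤ Real.exp (q * x) - 1 := by
          rw [Real.exp_nat_mul]
          have := x.2.1
          gcongr
          linarith [Real.add_one_le_exp (x : ℝ)]
      _ ≤ 2 * (q * x) := by
          have := (abs_le.1 (Real.abs_exp_sub_one_sub_id_le (abs_le.2 ⟨by linarith, hqx⟩))).2
          nlinarith
  rw [one_div, inv_pow, ← div_eq_mul_inv, le_div_iff₀ (by positivity), mul_comm]
  exact hmarkov

theorem sum_range_pow_dist_le {r : ℝ} (hr₀ : 0 ≤ r) (hr₁ : r < 1) (q c : ℕ) :
    ∑ m ∈ range q, r ^ Nat.dist m c ≤ 2 * (1 - r)⁻¹ := by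
  have hgeom (n : ℕ) : ∑ k ∈ range n, r ^ k ≤ (1 - r)⁻¹ :=
    sum_le_hasSum _ (fun _ _ => pow_nonneg hr₀ _) (hasSum_geometric_of_lt_one hr₀ hr₁)
  calc ∑ m ∈ range q, r ^ Nat.dist m c
      ≤ ∑ m ∈ range (c + q), r ^ Nat.dist m c :=
        sum_le_sum_of_subset_of_nonneg (range_mono (by omega)) fun _ _ _ => pow_nonneg hr₀ _
    _ = ∑ m ∈ range c, r ^ Nat.dist m c + ∑ m ∈ range q, r ^ Nat.dist (c + m) c :=
        sum_range_add _ _ _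
    _ ≤ ∑ m ∈ range c, r ^ (c - 1 - m) + ∑ m ∈ range q, r ^ m := by
        refine add_le_add (sum_le_sum fun m hm => ?_) (sum_le_sum fun m _ => ?_)
        · have := mem_range.1 hm
          exact pow_le_pow_of_le_one hr₀ hr₁.le (by unfold Nat.dist; omega)
        · exact pow_le_pow_of_le_one hr₀ hr₁.le (by unfold Nat.dist; omega)
    _ ≤ (1 - r)⁻¹ + (1 - r)⁻¹ := by
        rw [sum_range_reflect fun m => r ^ m]
        exact add_le_add (hgeom c) (hgeom q)
    _ = _ := by ring

theorem sum_range_exp_neg_mul_abs_sub_le {a : ℝ} (ha : 0 < a) (y : ℝ) (q : ℕ) :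
    ∑ m ∈ range q, Real.exp (-(a * |m - y|)) ≤ 2 * Real.exp (2 * a) / a := by
  have hdist (m : ℕ) : (Nat.dist m ⌊y⌋₊ : ℝ) ≤ |m - y| + 1 := by
    rcases lt_or_ge m ⌊y⌋₊ with h | h
    · have hfloor : (⌊y⌋₊ : ℝ) ≤ y := (Nat.le_floor_iff' (by omega)).1 le_rfl
      rw [Nat.dist_eq_sub_of_le h.le, Nat.cast_sub h.le]
      linarith [neg_le_abs (m - y)]
    · rw [Nat.dist_eq_sub_of_le_right h, Nat.cast_sub h]
      linarith [le_abs_self (m - y), Nat.lt_floor_add_one y]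
  have hterm (m : ℕ) :
      Real.exp (-(a * |m - y|)) ≤ Real.exp a * Real.exp (-a) ^ Nat.dist m ⌊y⌋₊ := by
    rw [← Real.exp_nat_mul, ← Real.exp_add, Real.exp_le_exp]
    nlinarith [hdist m]
  have hgap : a * Real.exp (-a) ≤ 1 - Real.exp (-a) := by
    have := mul_le_mul_of_nonneg_right (Real.add_one_le_exp a) (Real.exp_nonneg (-a))
    rw [← Real.exp_add, add_neg_cancel, Real.exp_zero] at this
    linarith
  calc ∑ m ∈ range q, Real.exp (-(a * |m - y|))
      ≤ Real.exp a * ∑ m ∈ range q, Real.exp (-a) ^ Nat.dist m ⌊y⌋₊ := by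
        rw [mul_sum]
        exact sum_le_sum fun m _ => hterm m
    _ ≤ Real.exp a * (2 * (1 - Real.exp (-a))⁻¹) := by
        gcongr
        exact sum_range_pow_dist_le (Real.exp_nonneg _)
          (Real.exp_lt_one_iff.2 (neg_lt_zero.2 ha)) q _
    _ ≤ Real.exp a * (2 * (a * Real.exp (-a))⁻¹) := by gcongr
    _ = 2 * Real.exp (2 * a) / a := by
        rw [mul_inv, ← Real.exp_neg, neg_neg, two_mul a, Real.exp_add]
        ring

/-- The potential `(x (1 - x)) ^ β` measures how far the erasure probability `x` is from the
extremes `0` and `1`. -/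
def potential (β : ℝ) (x : I) : ℝ := (x * σ x : ℝ) ^ β

theorem potential_nonneg (β : ℝ) (x : I) : 0 ≤ potential β x :=
  Real.rpow_nonneg (x * σ x).2.1 β

theorem potential_le_one {β : ℝ} (hβ : 0 ≤ β) (x : I) : potential β x ≤ 1 :=
  Real.rpow_le_one (x * σ x).2.1 (x * σ x).2.2 hβ

theorem potential_symm (β : ℝ) (x : I) : potential β (σ x) = potential β x := by
  rw [potential, potential, unitInterval.symm_symm, mul_comm]

theorem rpow_le_two_mul_potential {β : ℝ} (hβ : β ≤ 1) {x : I}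
    (hx : (x : ℝ) ≤ 1 / 2) : (x : ℝ) ^ β ≤ 2 * potential β x := by
  have hσ : (1 / 2 : ℝ) ≤ (σ x : ℝ) ^ β :=
    calc (1 / 2 : ℝ) ≤ σ x := by rw [unitInterval.coe_symm_eq]; linarith
      _ ≤ (σ x : ℝ) ^ β := Real.self_le_rpow_of_le_one (σ x).2.1 (σ x).2.2 hβ
  rw [potential, Real.mul_rpow x.2.1 (σ x).2.1]
  nlinarith [Real.rpow_nonneg x.2.1 β]

theorem sum_potential_binomialTail_le_of_one_le_mean {β : ℝ} (hβ : 0 < β) (q : ℕ) {x : I}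
    (hqx : 1 ≤ (q * x : ℝ)) :
    ∑ m ∈ range q, potential β (binomialTail q m x) ≤
      2 * Real.exp (3 * β) / β * √((q : ℝ) * x) := by
  have hsqrt : 1 ≤ √((q : ℝ) * x) := Real.one_le_sqrt.2 hqx
  set s := (√((q : ℝ) * x))⁻¹ with hs
  have hs₀ : 0 < s := by positivity
  have hs₁ : s ≤ 1 := inv_le_one_of_one_le₀ hsqrt
  have hmean_mul_sq : (q : ℝ) * x * s ^ 2 = 1 := by
    rw [hs, inv_pow, Real.sq_sqrt (by linarith), mul_inv_cancel₀ (by linarith)]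
  have hterm (m : ℕ) : potential β (binomialTail q m x) ≤
      Real.exp β * Real.exp (-(β * s * |m - (q : ℝ) * x|)) :=
    calc potential β (binomialTail q m x) ≤ Real.exp (1 - s * |m - (q : ℝ) * x|) ^ β :=
          Real.rpow_le_rpow (binomialTail q m x * σ (binomialTail q m x)).2.1
            (hmean_mul_sq ▸ mul_symm_binomialTail_le_exp q m x hs₀.le hs₁) hβ.le
      _ = _ := by
          rw [← Real.exp_mul, ← Real.exp_add]
          ring_nf
  calc ∑ m ∈ range q, potential β (binomialTail q m x)
      ≤ Real.exp β * ∑ m ∈ range q, Real.exp (-(β * s * |m - (q : ℝ) * x|)) := by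
        rw [mul_sum]
        exact sum_le_sum fun m _ => hterm m
    _ ≤ Real.exp β * (2 * Real.exp (2 * (β * s)) / (β * s)) := by
        gcongr
        exact sum_range_exp_neg_mul_abs_sub_le (by positivity) _ q
    _ ≤ Real.exp β * (2 * Real.exp (2 * β) / (β * s)) := by
        gcongr
        exact mul_le_of_le_one_right hβ.le hs₁
    _ = _ := by
        rw [hs, show 3 * β = β + 2 * β by ring, Real.exp_add]
        field_simp

theorem sum_potential_binomialTail_le_of_mean_le_one {β : ℝ} (hβ : 0 < β) {q : ℕ} {x : I}
    (hqx : (q * x : ℝ) ≤ 1) :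
    ∑ m ∈ range q, potential β (binomialTail q m x) ≤
      2 ^ β * (1 - (1 / 2 : ℝ) ^ β)⁻¹ * (q * x) ^ β := by
  have hy : (0 : ℝ) ≤ q * x := mul_nonneg q.cast_nonneg x.2.1
  have hratio : (1 / 2 : ℝ) ^ β < 1 := Real.rpow_lt_one (by norm_num) (by norm_num) hβ
  have hterm (m : ℕ) : potential β (binomialTail q m x) ≤
      2 ^ β * (q * x) ^ β * ((1 / 2 : ℝ) ^ β) ^ m :=
    calc potential β (binomialTail q m x) ≤ (binomialTail q m x : ℝ) ^ β :=
          Real.rpow_le_rpow (binomialTail q m x * σ (binomialTail q m x)).2.1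
            (mul_le_of_le_one_right (binomialTail q m x).2.1 (σ (binomialTail q m x)).2.2) hβ.le
      _ ≤ (2 * (q * x) * (1 / 2) ^ m) ^ β :=
          Real.rpow_le_rpow (binomialTail q m x).2.1 (binomialTail_le_of_mean_le_one q m hqx) hβ.le
      _ = _ := by
          rw [Real.mul_rpow (by positivity) (by positivity), Real.mul_rpow zero_le_two hy,
            Real.rpow_pow_comm (by norm_num)]
  calc ∑ m ∈ range q, potential β (binomialTail q m x)
      ≤ 2 ^ β * (q * x) ^ β * ∑ m ∈ range q, ((1 / 2 : ℝ) ^ β) ^ m := by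
        rw [mul_sum]
        exact sum_le_sum fun m _ => hterm m
    _ ≤ 2 ^ β * (q * x) ^ β * (1 - (1 / 2 : ℝ) ^ β)⁻¹ := by
        gcongr
        exact sum_le_hasSum _ (fun _ _ => by positivity)
          (hasSum_geometric_of_lt_one (by positivity) hratio)
    _ = _ := by ring

theorem sum_potential_binomialTail_le_max {β : ℝ} (hβ₀ : 0 < β) (hβ₁ : β ≤ 1 / 2) {q : ℕ}
    (hq : 1 ≤ q) (x : I) :
    ∑ m ∈ range q, potential β (binomialTail q m x) ≤
      max (2 * Real.exp (3 * β) / β) (2 ^ β * (1 - (1 / 2 : ℝ) ^ β)⁻¹) * (√q * (x : ℝ) ^ β) := by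
  have hxβ : 0 ≤ (x : ℝ) ^ β := Real.rpow_nonneg x.2.1 β
  rcases le_total 1 (q * x : ℝ) with h | h
  · have hx : (0 : ℝ) < x := pos_of_mul_pos_right (one_pos.trans_le h) q.cast_nonneg
    refine (sum_potential_binomialTail_le_of_one_le_mean hβ₀ q h).trans ?_
    refine mul_le_mul (le_max_left _ _) ?_ (Real.sqrt_nonneg _) (le_max_of_le_left (by positivity))
    calc √((q : ℝ) * x) = √q * (x : ℝ) ^ (1 / 2 : ℝ) := by
          rw [Real.sqrt_mul q.cast_nonneg, Real.sqrt_eq_rpow x]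
      _ ≤ √q * (x : ℝ) ^ β :=
          mul_le_mul_of_nonneg_left (Real.rpow_le_rpow_of_exponent_ge hx x.2.2 hβ₁)
            (Real.sqrt_nonneg q)
  · refine (sum_potential_binomialTail_le_of_mean_le_one hβ₀ h).trans ?_
    refine mul_le_mul (le_max_right _ _) ?_ (by have := x.2.1; positivity)
      (le_max_of_le_left (by positivity))
    calc (q * x : ℝ) ^ β = (q : ℝ) ^ β * (x : ℝ) ^ β := Real.mul_rpow q.cast_nonneg x.2.1
      _ ≤ √q * (x : ℝ) ^ β := by
          rw [Real.sqrt_eq_rpow]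
          exact mul_le_mul_of_nonneg_right
            (Real.rpow_le_rpow_of_exponent_le (Nat.one_le_cast.2 hq) hβ₁) hxβ

theorem exists_sum_potential_binomialTail_le {β : ℝ} (hβ₀ : 0 < β) (hβ₁ : β ≤ 1 / 2) :
    ∃ C : ℝ, ∀ q : ℕ, 1 ≤ q → ∀ x : I,
      ∑ m ∈ range q, potential β (binomialTail q m x) ≤ C * √q * potential β x := by
  set A := max (2 * Real.exp (3 * β) / β) (2 ^ β * (1 - (1 / 2 : ℝ) ^ β)⁻¹)
  have hA : 0 ≤ A := le_max_of_le_left (by positivity)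
  have hhalf {q : ℕ} (hq : 1 ≤ q) {x : I} (hx : (x : ℝ) ≤ 1 / 2) :
      ∑ m ∈ range q, potential β (binomialTail q m x) ≤ 2 * A * √q * potential β x :=
    calc ∑ m ∈ range q, potential β (binomialTail q m x) ≤ A * (√q * (x : ℝ) ^ β) :=
          sum_potential_binomialTail_le_max hβ₀ hβ₁ hq x
      _ ≤ A * (√q * (2 * potential β x)) := by
          gcongr
          exact rpow_le_two_mul_potential (by linarith) hx
      _ = 2 * A * √q * potential β x := by ring
  refine ⟨2 * A, fun q hq x => ?_⟩
  rcases le_total (x : ℝ) (1 / 2) with hx | hx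
  · exact hhalf hq hx
  · calc ∑ m ∈ range q, potential β (binomialTail q m x)
        = ∑ m ∈ range q, potential β (binomialTail q (q - 1 - m) (σ x)) :=
          sum_congr rfl fun m hm => by rw [binomialTail_symm (mem_range.1 hm), potential_symm]
      _ = ∑ m ∈ range q, potential β (binomialTail q m (σ x)) :=
          sum_range_reflect (fun m => potential β (binomialTail q m (σ x))) q
      _ ≤ 2 * A * √q * potential β (σ x) :=
          hhalf hq (by rw [unitInterval.coe_symm_eq]; linarith)
      _ = 2 * A * √q * potential β x := by rw [potential_symm]

section RandomSubset

variable {α : Type*} [Fintype α]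

/-- The probability that the random subset of `α` containing each element independently with
probability `x` is `S`. -/
def bernoulliWeight (x : ℝ) (S : Finset α) : ℝ := x ^ #S * (1 - x) ^ (Fintype.card α - #S)

theorem bernoulliWeight_nonneg (x : I) (S : Finset α) : 0 ≤ bernoulliWeight (x : ℝ) S :=
  mul_nonneg (pow_nonneg x.2.1 _) (pow_nonneg (sub_nonneg.2 x.2.2) _)

theorem bernoulliWeight_eq_prod [DecidableEq α] (x : ℝ) (S : Finset α) :
    bernoulliWeight x S = ∏ a, if a ∈ S then x else 1 - x := by
  rw [bernoulliWeight, prod_ite, prod_const, prod_const, filter_mem_eq_inter, univ_inter,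
    filter_not, filter_mem_eq_inter, univ_inter, card_univ_sdiff]

theorem sum_bernoulliWeight_mul_card (x : I) (f : ℕ → ℝ) :
    ∑ S : Finset α, bernoulliWeight (x : ℝ) S * f #S = ∫ k, f k ∂Bin(Fintype.card α, x) := by
  simp only [bernoulliWeight]
  rw [integral_binomial, ← Nat.range_succ_eq_Iic, ← powerset_univ,
    sum_powerset_apply_card fun k => (x : ℝ) ^ k * (1 - x) ^ (Fintype.card α - k) * f k, card_univ]
  refine sum_congr rfl fun k _ => ?_
  rw [nsmul_eq_mul, smul_eq_mul]
  ring

theorem sum_bernoulliWeight_card_mem (x : I) (A : Set ℕ) [DecidablePred (· ∈ A)] :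
    ∑ S : Finset α, (if #S ∈ A then bernoulliWeight (x : ℝ) S else 0) =
      Bin(Fintype.card α, x).real A := by
  rw [← integral_indicator_one .of_discrete, ← sum_bernoulliWeight_mul_card]
  refine sum_congr rfl fun S _ => ?_
  rw [Set.indicator_apply, mul_ite, Pi.one_apply, mul_one, mul_zero]

theorem sum_prod_bernoulliWeight_of_lt_card_iff {κ : Type*} [Fintype κ] [DecidableEq κ] (m : ℕ)
    (x : I) (T : Finset κ) :
    ∑ S : κ → Finset α, (if ∀ k, m < #(S k) ↔ k ∈ T then ∏ k, bernoulliWeight (x : ℝ) (S k)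
      else 0) = bernoulliWeight (binomialTail (Fintype.card α) m x : ℝ) T := by
  have hfiber (k : κ) :
      ∑ S : Finset α, (if m < #S ↔ k ∈ T then bernoulliWeight (x : ℝ) S else 0) =
        if k ∈ T then (binomialTail (Fintype.card α) m x : ℝ)
        else 1 - binomialTail (Fintype.card α) m x := by
    split_ifs with hk
    · simpa only [hk, iff_true, Set.mem_Ioi, coe_binomialTail]
        using sum_bernoulliWeight_card_mem (α := α) x (Set.Ioi m)
    · simpa only [hk, iff_false, not_lt, ← unitInterval.coe_symm_eq, coe_symm_binomialTail,
        Set.mem_Iic]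
        using sum_bernoulliWeight_card_mem (α := α) x (Set.Iic m)
  simp only [← Fintype.prod_ite_zero]
  rw [bernoulliWeight_eq_prod, ← prod_congr rfl fun k _ => hfiber k, Fintype.prod_sum]

open Classical in
/-- The erased symbols of the copy of the kernel formed by the positions with tail `k`. -/
def fiberErasures {n : ℕ} (E : Finset (Pos α (n + 1))) (k : Pos α n) : Finset α :=
  {a | (Fin.cons a k : Pos α (n + 1)) ∈ E}

theorem mem_fiberErasures {n : ℕ} {E : Finset (Pos α (n + 1))} {k : Pos α n} {a : α} :
    a ∈ fiberErasures E k ↔ (Fin.cons a k : Pos α (n + 1)) ∈ E := by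
  simp only [fiberErasures, mem_filter_univ]

/-- The erasure pattern left over from `E` once each copy of the kernel is decoded at its row `m`:
this fails for the copies with more than `m` erasures. -/
def reducePattern {n : ℕ} (m : ℕ) (E : Finset (Pos α (n + 1))) : Finset (Pos α n) :=
  {k | m < #(fiberErasures E k)}

theorem mem_reducePattern {n m : ℕ} {E : Finset (Pos α (n + 1))} {k : Pos α n} :
    k ∈ reducePattern m E ↔ m < #(fiberErasures E k) :=
  mem_filter_univ k

open Classical in
/-- An erasure pattern of length `q ^ (n + 1)` is a family of `q ^ n` patterns of length `q`. -/
def fiberErasuresEquiv (α : Type*) [Fintype α] (n : ℕ) :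
    Finset (Pos α (n + 1)) ≃ (Pos α n → Finset α) where
  toFun := fiberErasures
  invFun S := {k | k 0 ∈ S (Fin.tail k)}
  left_inv E := by
    ext k
    rw [mem_filter_univ, mem_fiberErasures, Fin.cons_self_tail]
  right_inv S := by
    ext k a
    rw [mem_fiberErasures, mem_filter_univ, Fin.cons_zero, Fin.tail_cons]

theorem bernoulliWeight_eq_prod_fiberErasures (x : ℝ) {n : ℕ} (E : Finset (Pos α (n + 1))) :
    bernoulliWeight x E = ∏ k, bernoulliWeight x (fiberErasures E k) := by
  classical
  simp only [bernoulliWeight_eq_prod, mem_fiberErasures]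
  rw [← (Fin.consEquiv fun _ => α).prod_comp, Fintype.prod_prod_type_right]
  rfl

open Classical in
theorem sum_bernoulliWeight_reducePattern_eq (m : ℕ) (x : I) {n : ℕ} (T : Finset (Pos α n)) :
    ∑ E : Finset (Pos α (n + 1)),
        (if reducePattern m E = T then bernoulliWeight (x : ℝ) E else 0) =
      bernoulliWeight (binomialTail (Fintype.card α) m x : ℝ) T := by
  rw [← sum_prod_bernoulliWeight_of_lt_card_iff]
  refine Fintype.sum_equiv (fiberErasuresEquiv α n) _ _ fun E => ?_
  rw [bernoulliWeight_eq_prod_fiberErasures]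
  exact if_congr (by simp only [Finset.ext_iff, mem_reducePattern]; rfl) rfl rfl

end RandomSubset

theorem patternProb_eq_bernoulliWeight {F : Type*} [Fintype F] (ε : ℝ) {n : ℕ}
    (E : Finset (Pos F n)) :
    patternProb F ε E = bernoulliWeight ε E := by
  rw [patternProb, bernoulliWeight, Fintype.card_pi_const]

theorem receive_eq_receive_iff {F : Type*} {n : ℕ} {E : Finset (Pos F n)} {x y : Pos F n → F} :
    receive E x = receive E y ↔ ∀ k ∉ E, x k = y k := by
  rw [funext_iff]
  refine forall_congr' fun k => ?_
  by_cases hk : k ∈ E <;> simp [receive, hk]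

variable {F : Type*} [Field F] [Fintype F]

/-- Ambiguity of the `i`-th input symbol when the zero codeword is sent: some input vector vanishing
before `i`, but not at `i`, has a codeword supported on the erased positions. -/
def IsAmbiguous {n : ℕ} (E : Finset (Pos F n)) (i : Idx F n) : Prop :=
  ∃ v : Idx F n → F, (∀ j, toLex j < toLex i → v j = 0) ∧ (∀ k ∉ E, encode v k = 0) ∧ v i ≠ 0

theorem isErased_iff_isAmbiguous {n : ℕ} (u : Idx F n → F) (E : Finset (Pos F n)) (i : Idx F n) :
    IsErased u E i ↔ IsAmbiguous E i := by
  constructor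
  · rintro ⟨v, hprev, hrec, hi⟩
    refine ⟨v - u, fun j hj => sub_eq_zero.2 (hprev j hj), fun k hk => ?_, sub_ne_zero.2 hi⟩
    rw [encode, Matrix.sub_vecMul]
    exact sub_eq_zero.2 (receive_eq_receive_iff.1 hrec k hk)
  · rintro ⟨v, hprev, hsupp, hi⟩
    refine ⟨u + v, fun j hj => add_eq_left.2 (hprev j hj),
      receive_eq_receive_iff.2 fun k hk => ?_, fun h => hi (add_eq_left.1 h)⟩
    rw [encode, Matrix.add_vecMul]
    exact add_eq_left.2 (hsupp k hk)

open Classical in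
theorem erasureRate_eq_sum (ε : ℝ) {n : ℕ} (i : Idx F n) :
    erasureRate F ε n i =
      ∑ E : Finset (Pos F n), if IsAmbiguous E i then bernoulliWeight ε E else 0 := by
  simp only [erasureRate, isErased_iff_isAmbiguous, patternProb_eq_bernoulliWeight]
  rw [sum_const, card_univ, nsmul_eq_mul, mul_div_cancel_left₀]
  exact Nat.cast_ne_zero.2 Fintype.card_ne_zero

theorem toLex_cons_lt_toLex_cons {α : Type*} [LT α] {n : ℕ} {a b : α} {j k : Fin n → α} :
    toLex (Fin.cons a j : Fin (n + 1) → α) < toLex (Fin.cons b k : Fin (n + 1) → α) ↔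
      a < b ∨ a = b ∧ toLex j < toLex k :=
  Fin.pi_lex_lt_cons_cons _

theorem encode_cons {n : ℕ} (v : Idx F (n + 1) → F) (a : F) (k : Pos F n) :
    encode v (Fin.cons a k : Pos F (n + 1)) =
      ∑ m, kernel F m a * encode (fun j : Idx F n => v (Fin.cons m j)) k := by
  simp only [encode, Matrix.vecMul, dotProduct]
  rw [← (Fin.consEquiv fun _ => Fin (Fintype.card F)).sum_comp, Fintype.sum_prod_type]
  refine sum_congr rfl fun m _ => ?_
  rw [mul_sum]
  refine sum_congr rfl fun j _ => ?_
  simp only [Fin.consEquiv, Equiv.coe_fn_mk, transform, Fin.prod_univ_succ, Fin.cons_zero,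
    Fin.cons_succ]
  ring

/-- A combination of the kernel rows from `m` on is a polynomial of degree at most `q - 1 - m`. -/
theorem coeff_eq_zero_of_kernel_sum_eq_zero {w : Fin (Fintype.card F) → F}
    {m : Fin (Fintype.card F)} (hw : ∀ j < m, w j = 0) {s : Finset F}
    (hs : ∀ a ∈ s, ∑ j, kernel F j a * w j = 0) (hcard : Fintype.card F - 1 - m < #s) :
    w m = 0 := by
  set p : Polynomial F :=
    ∑ j : Fin (Fintype.card F), Polynomial.monomial (Fintype.card F - 1 - (j : ℕ)) (w j) with hp
  have hdegree : p.natDegree ≤ Fintype.card F - 1 - m := by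
    refine Polynomial.natDegree_sum_le_of_forall_le _ _ fun j _ => ?_
    rcases lt_or_ge j m with h | h
    · simp only [hw j h, map_zero, Polynomial.natDegree_zero, zero_le]
    · exact (Polynomial.natDegree_monomial_le _).trans (Nat.sub_le_sub_left h _)
  have hroots : ∀ a ∈ s, p.eval a = 0 := fun a ha => by
    rw [hp, Polynomial.eval_finsetSum, ← hs a ha]
    exact sum_congr rfl fun j _ => by rw [Polynomial.eval_monomial, kernel, mul_comm]
  have hzero : p = 0 :=
    Polynomial.eq_zero_of_natDegree_lt_card_of_eval_eq_zero' p s hroots (hdegree.trans_lt hcard)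
  have hcoeff : p.coeff (Fintype.card F - 1 - m) = w m := by
    rw [hp, Polynomial.finsetSum_coeff, sum_eq_single m]
    · exact Polynomial.coeff_monomial_same _ _
    · exact fun j _ hj => Polynomial.coeff_monomial_of_ne _ fun h => hj (Fin.ext (by omega))
    · exact fun h => absurd (mem_univ m) h
  rw [← hcoeff, hzero, Polynomial.coeff_zero]

theorem IsAmbiguous.reducePattern {n : ℕ} {E : Finset (Pos F (n + 1))}
    {m : Fin (Fintype.card F)} {i : Idx F n} (h : IsAmbiguous E (Fin.cons m i : Idx F (n + 1))) :
    IsAmbiguous (reducePattern m E) i := by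
  classical
  obtain ⟨v, hprev, hsupp, hi⟩ := h
  refine ⟨fun j => v (Fin.cons m j),
    fun j hj => hprev _ (toLex_cons_lt_toLex_cons.2 (.inr ⟨rfl, hj⟩)), fun k hk => ?_, hi⟩
  have hrows : ∀ l < m, encode (fun j : Idx F n => v (Fin.cons l j)) k = 0 := fun l hl => by
    have hv : (fun j : Idx F n => v (Fin.cons l j)) = 0 :=
      funext fun j => hprev _ (toLex_cons_lt_toLex_cons.2 (.inl hl))
    rw [hv, encode, Matrix.zero_vecMul, Pi.zero_apply]
  refine coeff_eq_zero_of_kernel_sum_eq_zero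
    (w := fun l => encode (fun j : Idx F n => v (Fin.cons l j)) k) (s := (fiberErasures E k)ᶜ)
    hrows (fun a ha => ?_) ?_
  · rw [← encode_cons]
    exact hsupp _ (mt mem_fiberErasures.2 (mem_compl.1 ha))
  · rw [mem_reducePattern, not_lt] at hk
    have := m.isLt
    rw [card_compl]
    omega

theorem erasureRate_cons_le (x : I) {n : ℕ} (m : Fin (Fintype.card F)) (i : Idx F n) :
    erasureRate F x (n + 1) (Fin.cons m i : Idx F (n + 1)) ≤
      erasureRate F (binomialTail (Fintype.card F) m x) n i := by
  classical
  rw [erasureRate_eq_sum, erasureRate_eq_sum]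
  calc ∑ E : Finset (Pos F (n + 1)),
        (if IsAmbiguous E (Fin.cons m i : Idx F (n + 1)) then bernoulliWeight (x : ℝ) E else 0)
      ≤ ∑ E : Finset (Pos F (n + 1)),
          if IsAmbiguous (reducePattern m E) i then bernoulliWeight (x : ℝ) E else 0 := by
        refine sum_le_sum fun E _ => ?_
        by_cases h : IsAmbiguous E (Fin.cons m i : Idx F (n + 1))
        · rw [if_pos h, if_pos h.reducePattern]
        · rw [if_neg h]
          exact ite_nonneg (bernoulliWeight_nonneg x E) le_rfl
    _ = ∑ T : Finset (Pos F n), ∑ E : Finset (Pos F (n + 1)),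
          if reducePattern m E = T then
            if IsAmbiguous T i then bernoulliWeight (x : ℝ) E else 0
          else 0 := by
        rw [sum_comm]
        exact sum_congr rfl fun E _ => by rw [sum_ite_eq, if_pos (mem_univ _)]
    _ = _ := by
        refine sum_congr rfl fun T _ => ?_
        rw [← sum_bernoulliWeight_reducePattern_eq]
        split_ifs
        exacts [rfl, by simp only [ite_self, sum_const_zero]]

theorem encode_zero_length (v : Idx F 0 → F) (k : Pos F 0) (i : Idx F 0) : encode v k = v i := by
  simp only [encode, Matrix.vecMul, dotProduct, transform, univ_eq_empty, prod_empty, mul_one,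
    univ_unique, sum_singleton]
  exact congrArg v (Subsingleton.elim _ _)

theorem erasureRate_zero_le (x : I) (i : Idx F 0) : erasureRate F x 0 i ≤ x := by
  classical
  have hunerased : ∀ E : Finset (Pos F 0), E ≠ univ → ¬ IsAmbiguous E i := by
    rintro E hE ⟨v, -, hsupp, hi⟩
    obtain ⟨k, hk⟩ : ∃ k, k ∉ E := by simpa only [ne_eq, eq_univ_iff_forall, not_forall] using hE
    exact hi (encode_zero_length v k i ▸ hsupp k hk)
  rw [erasureRate_eq_sum, sum_eq_single univ (fun E _ hE => if_neg (hunerased E hE))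
    fun h => absurd (mem_univ _) h]
  split_ifs
  · rw [bernoulliWeight, card_univ, Nat.sub_self, Fintype.card_unique, pow_one, pow_zero,
      mul_one]
  · exact x.2.1

/-- The erasure probability reached from `x` after `n` polarization steps, the step taken at row `m`
of the kernel replacing an erasure probability by its binomial tail at `m`. -/
def tailProcess (q : ℕ) : (n : ℕ) → I → (Fin n → Fin q) → I
  | 0, x, _ => x
  | n + 1, x, i => tailProcess q n (binomialTail q (i 0) x) (Fin.tail i)

theorem sum_tailProcess_succ (q n : ℕ) (x : I) (g : I → ℝ) :
    ∑ i, g (tailProcess q (n + 1) x i) =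
      ∑ m ∈ range q, ∑ i, g (tailProcess q n (binomialTail q m x) i) := by
  rw [← (Fin.consEquiv fun _ => Fin q).sum_comp, Fintype.sum_prod_type,
    sum_range fun m => ∑ i, g (tailProcess q n (binomialTail q m x) i)]
  rfl

theorem sum_tailProcess (q n : ℕ) (x : I) :
    ∑ i, (tailProcess q n x i : ℝ) = (q : ℝ) ^ n * x := by
  induction n generalizing x with
  | zero => simp only [tailProcess, univ_unique, sum_const, card_singleton, one_smul, pow_zero,
      one_mul]
  | succ n ih =>
    rw [sum_tailProcess_succ q n x Subtype.val, sum_congr rfl fun m _ => ih _, ← mul_sum,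
      sum_binomialTail, pow_succ, mul_assoc]

theorem sum_potential_tailProcess_le {β c : ℝ} (hc : 0 ≤ c) {q : ℕ}
    (hstep : ∀ x : I, ∑ m ∈ range q, potential β (binomialTail q m x) ≤ c * potential β x)
    (n : ℕ) (x : I) :
    ∑ i, potential β (tailProcess q n x i) ≤ c ^ n * potential β x := by
  induction n generalizing x with
  | zero => simp only [tailProcess, univ_unique, sum_const, card_singleton, one_smul, pow_zero,
      one_mul, le_refl]
  | succ n ih =>
    rw [sum_tailProcess_succ q n x (potential β)]
    calc ∑ m ∈ range q, ∑ i, potential β (tailProcess q n (binomialTail q m x) i)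
        ≤ ∑ m ∈ range q, c ^ n * potential β (binomialTail q m x) := sum_le_sum fun m _ => ih _
      _ ≤ c ^ n * (c * potential β x) := by
          rw [← mul_sum]
          exact mul_le_mul_of_nonneg_left (hstep x) (pow_nonneg hc n)
      _ = c ^ (n + 1) * potential β x := by rw [pow_succ, mul_assoc]

theorem erasureRate_le_tailProcess (x : I) {n : ℕ} (i : Idx F n) :
    erasureRate F x n i ≤ tailProcess (Fintype.card F) n x i := by
  induction n generalizing x with
  | zero => exact erasureRate_zero_le x i
  | succ n ih =>
    rw [← Fin.cons_self_tail i]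
    exact (erasureRate_cons_le x (i 0) (Fin.tail i)).trans (ih _ _)

theorem one_le_add_potential {β η : ℝ} (hβ₀ : 0 ≤ β) (hβ₁ : β ≤ 1) (hη : 0 < η) {z : I}
    (hz : η < z) : 1 ≤ z + η ^ (-β) * potential β z := by
  have hsymm : 1 - (z : ℝ) ≤ (σ z : ℝ) ^ β :=
    Real.self_le_rpow_of_le_one (σ z).2.1 (σ z).2.2 hβ₁
  have hpow : 1 ≤ η ^ (-β) * (z : ℝ) ^ β := by
    rw [Real.rpow_neg hη.le, ← div_eq_inv_mul, one_le_div (by positivity)]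
    exact Real.rpow_le_rpow hη.le hz.le hβ₀
  rw [potential, Real.mul_rpow z.2.1 (σ z).2.1, ← mul_assoc]
  nlinarith [Real.rpow_nonneg (σ z).2.1 β]

/-- Markov's inequality for the potential, combined with the conservation of the mean. -/
theorem le_fractionAtMost {β η : ℝ} (hβ₀ : 0 ≤ β) (hβ₁ : β ≤ 1) (hη : 0 < η) (x : I) (n : ℕ) :
    1 - x - η ^ (-β) * ((∑ i, potential β (tailProcess (Fintype.card F) n x i)) /
      (Fintype.card F : ℝ) ^ n) ≤ fractionAtMost F x n η := by
  classical
  set z := tailProcess (Fintype.card F) n x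
  have hcard : (0 : ℝ) < (Fintype.card F : ℝ) ^ n :=
    pow_pos (Nat.cast_pos.2 Fintype.card_pos) n
  have hpointwise (i : Idx F n) : (1 : ℝ) ≤ (if erasureRate F x n i ≤ η then 1 else 0) +
      (z i + η ^ (-β) * potential β (z i)) := by
    have hpotential : 0 ≤ η ^ (-β) * potential β (z i) :=
      mul_nonneg (Real.rpow_nonneg hη.le _) (potential_nonneg β _)
    split_ifs with h
    · linarith [(z i).2.1]
    · rw [zero_add]
      exact one_le_add_potential hβ₀ hβ₁ hη ((not_le.1 h).trans_le (erasureRate_le_tailProcess x i))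
  have hcount := sum_le_sum fun i (_ : i ∈ univ) => hpointwise i
  rw [sum_add_distrib, sum_add_distrib, sum_boole, ← mul_sum, sum_tailProcess, sum_const,
    card_univ, Fintype.card_pi_const, Fintype.card_fin, nsmul_one, Nat.cast_pow] at hcount
  rw [fractionAtMost, le_div_iff₀ hcard, sub_mul, sub_mul, mul_assoc, div_mul_cancel₀ _ hcard.ne']
  linarith

theorem average_potential_tailProcess_le {β s : ℝ} (hβ : 0 ≤ β) {q : ℕ} (hq : 0 < q)
    (hstep : ∀ x : I,
      ∑ m ∈ range q, potential β (binomialTail q m x) ≤ (q : ℝ) ^ (1 / 2 + s) * potential β x)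
    (n : ℕ) (x : I) :
    (∑ i, potential β (tailProcess q n x i)) / (q : ℝ) ^ n ≤ ((q : ℝ) ^ n) ^ (-(1 / 2) + s) := by
  have hN : (0 : ℝ) < (q : ℝ) ^ n := pow_pos (Nat.cast_pos.2 hq) n
  rw [div_le_iff₀ hN]
  calc ∑ i, potential β (tailProcess q n x i)
      ≤ ((q : ℝ) ^ (1 / 2 + s)) ^ n * potential β x :=
        sum_potential_tailProcess_le (by positivity) hstep n x
    _ ≤ ((q : ℝ) ^ (1 / 2 + s)) ^ n :=
        mul_le_of_le_one_right (by positivity) (potential_le_one hβ x)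
    _ = ((q : ℝ) ^ n) ^ (-(1 / 2) + s) * (q : ℝ) ^ n := by
        rw [Real.rpow_pow_comm q.cast_nonneg, ← Real.rpow_add_one hN.ne']
        ring_nf

theorem exists_forall_le_fractionAtMost {β γ δ : ℝ} (hβ₀ : 0 < β) (hβ₁ : β ≤ 1 / 2)
    (hγδ : γ * β < δ) :
    ∃ q₀ : ℕ, ∀ (F : Type*) [Field F] [Fintype F], q₀ ≤ Fintype.card F → ∀ (ε : I) (n : ℕ),
      1 - ε - ((Fintype.card F : ℝ) ^ n) ^ (-(1 / 2) + δ) ≤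
        fractionAtMost F ε n (((Fintype.card F : ℝ) ^ n) ^ (-γ)) := by
  obtain ⟨C, hC⟩ := exists_sum_potential_binomialTail_le hβ₀ hβ₁
  obtain ⟨q₀, hq₀⟩ := Filter.eventually_atTop.1
    (((tendsto_rpow_atTop (sub_pos.2 hγδ)).comp tendsto_natCast_atTop_atTop).eventually_ge_atTop C)
  refine ⟨q₀, fun F _ _ hF ε n => ?_⟩
  have hq : 0 < Fintype.card F := Fintype.card_pos
  have hN : (0 : ℝ) < (Fintype.card F : ℝ) ^ n := pow_pos (Nat.cast_pos.2 hq) n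
  refine le_trans ?_ (le_fractionAtMost hβ₀.le (by linarith) (Real.rpow_pos_of_pos hN _) ε n)
  have haverage := average_potential_tailProcess_le (s := δ - γ * β) hβ₀.le hq (fun x => by
    refine (hC _ hq x).trans (mul_le_mul_of_nonneg_right ?_ (potential_nonneg β x))
    rw [add_comm, Real.rpow_add (Nat.cast_pos.2 hq), ← Real.sqrt_eq_rpow]
    exact mul_le_mul_of_nonneg_right (hq₀ _ hF) (Real.sqrt_nonneg _)) n ε
  refine sub_le_sub_left ((mul_le_mul_of_nonneg_left haverage (by positivity)).trans_eq ?_) _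
  rw [← Real.rpow_mul hN.le, ← Real.rpow_add hN]
  ring_nf

end RSPolar

end

theorem mainTheorem2 (ε : ℝ) (hε₀ : 0 ≤ ε) (hε₁ : ε ≤ 1)
    (γ : ℝ) (hγ : 0 < γ) (δ : ℝ) (hδ : 0 < δ) :
    ∃ β : ℝ, 0 < β ∧ β ≤ 1 / 2 ∧ ∃ q₀ : ℕ,
      ∀ q : ℕ, IsPrimePow q → q₀ ≤ q →
      ∀ (F : Type*) [Field F] [Fintype F], Fintype.card F = q →
      ∀ (n : ℕ) (N : ℝ), N = (q : ℝ) ^ n →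
        1 - ε - 5 * N ^ (-(1 / 2 : ℝ) + δ) ≤
          RSPolar.fractionAtMost F ε n (N ^ (-γ)) := by
  set β := min (1 / 2) (δ / (2 * γ))
  have hβ₀ : 0 < β := by positivity
  have hβ₁ : β ≤ 1 / 2 := min_le_left _ _
  have hγβ : γ * β < δ :=
    calc γ * β ≤ γ * (δ / (2 * γ)) := mul_le_mul_of_nonneg_left (min_le_right _ _) hγ.le
      _ = δ / 2 := by field_simp
      _ < δ := half_lt_self hδ
  obtain ⟨q₀, hq₀⟩ := RSPolar.exists_forall_le_fractionAtMost hβ₀ hβ₁ hγβ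
  refine ⟨β, hβ₀, hβ₁, q₀, ?_⟩
  rintro _ - hq F _ _ rfl n _ rfl
  have hpow : 0 ≤ ((Fintype.card F : ℝ) ^ n) ^ (-(1 / 2 : ℝ) + δ) := by positivity
  linarith [hq₀ F hq ⟨ε, hε₀, hε₁⟩ n]
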